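/- Let $\omega_0,\omega_1,\omega_2\in\mathbb{R}$ with $\omega_0^2+\omega_1^2+\omega_2^2=1$, put $\alpha=\omega_2^2$ and $\beta=\omega_0^2$ (so $\alpha,\beta\ge 0$ and $\alpha+\beta\le 1$), and assume $\beta<1$. Let $m>0$ and $\overline\gamma>0$ be real. Let $\xi,\phi,G_1,G_2,G_3$ be independent, where $\xi$ is Gamma distributed with density $\frac{m^m u^{m-1}}{\Gamma(m)}e^{-mu}$ on $u>0$, $\phi$ is uniform on $[0,2\pi)$, and $G_1,G_2,G_3$ are circularly symmetric complex normal with mean $0$ and variance $1$. Let $\gamma$ be a random variable with the same distribution as $$\overline\gamma\,\bigl|\omega_0\sqrt{\xi}\,e^{j\phi}+\omega_1G_1+\omega_2G_2G_3\bigr|^2$$ (the fluctuating second order scattering fading, or fSOSF, distribution with parameters $\alpha,\beta,m;\overline\gamma$). For $x>0$ put $$\overline\gamma_x=\overline\gamma\,(1-\alpha(1-x)),\qquad K_x=\frac{\beta}{1-\beta-\alpha(1-x)}.$$ Then $\gamma$ has a probability density function $f_\gamma$ with respect to Lebesgue measure; it vanishes on $(-\infty,0]$ (densities being understood up to null sets)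 and the following holds. 1. For $u>0$, $$f_\gamma(u)=\int_0^\infty \frac{m^m(1+K_x)}{(m+K_x)^m\,\overline\gamma_x}\,e^{-\frac{1+K_x}{\overline\gamma_x}u-x}\;{}_1F_1\!\left(m;1;\frac{K_x(1+K_x)}{K_x+m}\,\frac{u}{\overline\gamma_x}\right)dx,$$ where the integral converges absolutely and ${}_1F_1$ is Kummer's hypergeometric function. 2. If $m$ is a positive integer and $\alpha>0$, then for every $u>0$ the integral in 1 is equal to $$\sum_{j=0}^{m-1}\binom{m-1}{j}\frac{u^{m-j-1}\,e^{z}\left(\frac{\beta}{m}\right)^{m-j-1}}{\overline\gamma^{\,m-j}\,(m-j-1)!\;\alpha^{2m-j-1}}\sum_{r=0}^{j}\binom{j}{r}\left(\frac{-\beta}{m}\right)^{j-r}\alpha^{r}\;\Gamma\!\left(r-2m+j+2,\;z,\;\frac{u}{\alpha\overline\gamma}\right),\qquad z=\frac{m(1-\alpha-\beta)+\beta}{m\alpha},$$ so that this sum is $f_\gamma(u)$, where $\Gamma(a,z,b)=\int_z^\infty t^{a-1}e^{-t}e^{-b/t}\,dt$ and all these integrals converge; here $0^0=1$. -/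

import Mathlib

open MeasureTheory ProbabilityTheory
open scoped NNReal

noncomputable section

namespace FSOSF

/-- The circularly symmetric complex normal distribution with mean `μ` and variance `v`:
independent real and imaginary parts, each of variance `v / 2`. -/
def complexNormal (μ : ℂ) (v : ℝ≥0) : Measure ℂ :=
  ((gaussianReal μ.re (v / 2)).prod (gaussianReal μ.im (v / 2))).map
    (fun p : ℝ × ℝ => (⟨p.1, p.2⟩ : ℂ))

/-- The uniform distribution on `[0, 2π)`. -/
def uniformPhase : Measure ℝ :=
  ProbabilityTheory.cond volume (Set.Ico 0 (2 * Real.pi))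

/-- The joint law of the independent variables `(ξ, φ, G₁, G₂, G₃)`: `ξ` is Gamma distributed with
shape `m` and rate `m` (hence mean one), `φ` is uniform on `[0, 2π)`, and the `Gᵢ` are standard
circularly symmetric complex normal. -/
def sourceLaw (m : ℝ) : Measure (ℝ × ℝ × ℂ × ℂ × ℂ) :=
  (gammaMeasure m m).prod (uniformPhase.prod
    ((complexNormal 0 1).prod ((complexNormal 0 1).prod (complexNormal 0 1))))

/-- The received signal `S = ω₀ √ξ e^{jφ} + ω₁ G₁ + ω₂ G₂ G₃`, as a function of
`(ξ, φ, G₁, G₂, G₃)`. -/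
def signal (ω₀ ω₁ ω₂ : ℝ) (s : ℝ × ℝ × ℂ × ℂ × ℂ) : ℂ :=
  match s with
  | (ξ, φ, g₁, g₂, g₃) =>
    (ω₀ : ℂ) * (Real.sqrt ξ : ℂ) * Complex.exp (Complex.I * (φ : ℂ))
      + (ω₁ : ℂ) * g₁ + (ω₂ : ℂ) * g₂ * g₃

/-- The law of the instantaneous SNR `γbar * |S|²`. -/
def snrLaw (ω₀ ω₁ ω₂ m γbar : ℝ) : Measure ℝ :=
  (sourceLaw m).map (fun s => γbar * ‖signal ω₀ ω₁ ω₂ s‖ ^ 2)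

/-- The random variable `γ` is fSOSF distributed with shape parameters `α, β, m` and average SNR
`γbar`: it has the law of `γbar * |S|²` for a normalized signal `S` whose weights have the
parameters `α` and `β`. -/
def IsFSOSF {Ω : Type*} [MeasurableSpace Ω] (P : Measure Ω) (γ : Ω → ℝ)
    (α β m γbar : ℝ) : Prop :=
  ∃ ω₀ ω₁ ω₂ : ℝ, ω₀ ^ 2 + ω₁ ^ 2 + ω₂ ^ 2 = 1 ∧
    α = ω₂ ^ 2 / (ω₀ ^ 2 + ω₁ ^ 2 + ω₂ ^ 2) ∧
    β = ω₀ ^ 2 / (ω₀ ^ 2 + ω₁ ^ 2 + ω₂ ^ 2) ∧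
    HasLaw γ (snrLaw ω₀ ω₁ ω₂ m γbar) P

/-- Kummer's confluent hypergeometric function `₁F₁(a; c; z)`. -/
def kummer (a c z : ℝ) : ℝ :=
  ∑' n : ℕ, (ascPochhammer ℝ n).eval a / (ascPochhammer ℝ n).eval c * (z ^ n / (n.factorial : ℝ))

/-- The integrand `t ^ (a - 1) * e ^ (-t) * e ^ (-b / t)`. -/
def genGammaIntegrand (a b t : ℝ) : ℝ :=
  t ^ (a - 1) * Real.exp (-t) * Real.exp (-b / t)

/-- The generalized incomplete gamma function `Γ(a, z, b)`. -/
def genGamma (a z b : ℝ) : ℝ :=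
  ∫ t in Set.Ioi z, genGammaIntegrand a b t

/-- The conditional average SNR given `|G₃|² = x`. -/
def avgSNR (α γbar x : ℝ) : ℝ := γbar * (1 - α * (1 - x))

/-- The conditional Rician factor given `|G₃|² = x`. -/
def ricianK (α β x : ℝ) : ℝ := β / (1 - β - α * (1 - x))

/-- The integrand, in `x`, of the integral form of the density at `u`. -/
def pdfIntegrand (α β m γbar u x : ℝ) : ℝ :=
  m ^ m * (1 + ricianK α β x) / ((m + ricianK α β x) ^ m * avgSNR α γbar x)
    * Real.exp (-((1 + ricianK α β x) / avgSNR α γbar x) * u - x)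
    * kummer m 1
        (ricianK α β x * (1 + ricianK α β x) / (ricianK α β x + m) * (u / avgSNR α γbar x))

/-- The integral form of the density, for real `m > 0`. -/
def pdfIntegral (α β m γbar u : ℝ) : ℝ :=
  ∫ x in Set.Ioi (0 : ℝ), pdfIntegrand α β m γbar u x

/-- The lower limit `(m (1 - α - β) + β) / (m α)`. -/
def lowerLimit (α β : ℝ) (m : ℕ) : ℝ := (m * (1 - α - β) + β) / (m * α)

/-- The finite-sum form of the density, for positive integer `m`. -/
def pdfSum (α β : ℝ) (m : ℕ) (γbar u : ℝ) : ℝ :=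
  ∑ j ∈ Finset.range m,
    ((m - 1).choose j : ℝ)
      * (u ^ (m - j - 1) * Real.exp (lowerLimit α β m) * (β / m) ^ (m - j - 1)
        / (γbar ^ (m - j) * ((m - j - 1).factorial : ℝ) * α ^ (2 * m - j - 1)))
      * ∑ r ∈ Finset.range (j + 1),
          (j.choose r : ℝ) * (-β / m) ^ (j - r) * α ^ r
            * genGamma ((r : ℝ) - 2 * m + j + 2) (lowerLimit α β m) (u / (α * γbar))

end FSOSF

end

/-!
The density comes from conditioning on the variables one at a time.

Given `G₃ = g`, the diffuse part `ω₁ G₁ + ω₂ G₂ g` is complex normal of variance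
`s = ω₁² + ω₂² |g|²`, by comparing characteristic functions (`map_linear_complexNormal`). Adding a
component of amplitude `a` and uniform phase and passing to polar coordinates gives the Rician
density `s⁻¹ e^{-(v + a²)/s} I₀(2a√v/s)` of the squared modulus (`lintegral_rice`); the Bessel
function enters as the series `∑ yⁿ / n!²`, through the integrals of the even powers of the cosine.
Since `a² = ω₀² ξ` with `ξ` Gamma distributed, integrating this series term by term gives Kummer's
series (`lintegral_gamma_rice`). Finally `|G₃|²` is exponentially distributed, which is the Rician
law with amplitude zero, and mixing over it gives the integral form (`snrLaw_eq_withDensity`). All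
of this takes place in `[0, ∞]`, where Tonelli's theorem needs no integrability.

Convergence of the integral at every `u > 0`, not merely at almost every one, needs a separate
bound, because `s` may tend to zero as `x → 0` (`integrableOn_pdfIntegrand`). It follows from the
monotonicity of `₁F₁(m; 1; y)` in `m` together with Kummer's transformation at integers,
`₁F₁(k + 1; 1; y) = eʸ ∑ᵢ (k choose i) yⁱ / i!` (`kummer_nat`), which is Vandermonde's identity.
The same transformation makes the integrand elementary when `m` is an integer; substituting
`t = x + z` and expanding a power of `s = α t - β / m` by the binomial theorem then yields the
finite sum (`pdfIntegral_eq_pdfSum`).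
-/

namespace FSOSF

/-! ### Kummer's function with lower parameter one -/

lemma ascPochhammer_eval_nonneg {m : ℝ} (hm : 0 < m) (n : ℕ) :
    0 ≤ (ascPochhammer ℝ n).eval m :=
  (ascPochhammer_pos n m hm).le

lemma ascPochhammer_eval_mono {a b : ℝ} (ha : 0 < a) (hab : a ≤ b) (n : ℕ) :
    (ascPochhammer ℝ n).eval a ≤ (ascPochhammer ℝ n).eval b := by
  induction n with
  | zero => simp
  | succ n ih =>
    rw [ascPochhammer_succ_eval, ascPochhammer_succ_eval]
    have := ascPochhammer_eval_nonneg (ha.trans_le hab) n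
    gcongr

/-- Vandermonde's identity, in the form of an expansion of `(k + 1)ₙ / n!` in the binomial
coefficients `n.choose i`. -/
lemma ascPochhammer_eval_succ_div_factorial (k n : ℕ) :
    (ascPochhammer ℝ n).eval ((k : ℝ) + 1) / (n.factorial : ℝ)
      = ∑ i ∈ Finset.range (k + 1), (k.choose i : ℝ) * (n.choose i : ℝ) := by
  have h1 : (ascPochhammer ℝ n).eval ((k : ℝ) + 1) = (((k + 1).ascFactorial n : ℕ) : ℝ) := by
    rw [← ascPochhammer_nat_eq_natCast_ascFactorial]; push_cast; rfl
  have h2 : (n.factorial : ℝ) ≠ 0 := by positivity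
  rw [h1, Nat.ascFactorial_eq_factorial_mul_choose, div_eq_iff h2]
  have h3 : (k + n).choose n = ∑ i ∈ Finset.range (k + 1), k.choose i * n.choose i := by
    rw [← Nat.choose_symm_add, Nat.add_comm k n, Nat.add_choose_eq,
      Finset.Nat.sum_antidiagonal_eq_sum_range_succ_mk]
    refine Finset.sum_congr rfl fun i hi => ?_
    have hi : i ≤ k := Nat.lt_succ_iff.1 (Finset.mem_range.1 hi)
    simp only
    rw [Nat.choose_symm hi, mul_comm]
  rw [h3]
  push_cast
  ring

lemma hasSum_choose_mul_pow_div_factorial (i : ℕ) (y : ℝ) :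
    HasSum (fun n : ℕ => (n.choose i : ℝ) * (y ^ n / n.factorial))
      (y ^ i / i.factorial * Real.exp y) := by
  have h : HasSum (fun n : ℕ => y ^ i / i.factorial * (y ^ n / n.factorial))
      (y ^ i / i.factorial * Real.exp y) := by
    rw [Real.exp_eq_exp_ℝ]
    exact (NormedSpace.expSeries_div_hasSum_exp y).mul_left _
  have hinj : Function.Injective (fun n : ℕ => n + i) := add_left_injective i
  rw [← hinj.hasSum_iff]
  · convert h using 2 with n
    have h1 : ((n + i).choose i : ℝ) * (n.factorial : ℝ) * (i.factorial : ℝ)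
        = ((n + i).factorial : ℝ) := by
      have := Nat.choose_mul_factorial_mul_factorial (Nat.le_add_left i n)
      rw [Nat.add_sub_cancel] at this
      rw [← this]
      push_cast
      ring
    have h2 : (n.factorial : ℝ) ≠ 0 := by positivity
    have h3 : (i.factorial : ℝ) ≠ 0 := by positivity
    have h4 : ((n + i).factorial : ℝ) ≠ 0 := by positivity
    simp only [Function.comp]
    field_simp
    rw [← h1, pow_add]
    ring
  · intro n hn
    have : n < i := by
      by_contra hcon
      exact hn ⟨n - i, by simp only; omega⟩
    simp [Nat.choose_eq_zero_of_lt this]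

lemma hasSum_kummer_nat (k : ℕ) (y : ℝ) :
    HasSum (fun n : ℕ => (ascPochhammer ℝ n).eval ((k : ℝ) + 1) / (ascPochhammer ℝ n).eval 1
        * (y ^ n / (n.factorial : ℝ)))
      (Real.exp y * ∑ i ∈ Finset.range (k + 1), (k.choose i : ℝ) * (y ^ i / i.factorial)) := by
  have := hasSum_sum (s := Finset.range (k + 1)) fun i _ =>
    (hasSum_choose_mul_pow_div_factorial i y).mul_left (k.choose i : ℝ)
  convert this using 1
  · rfl
  · ext n
    rw [ascPochhammer_eval_one, ascPochhammer_eval_succ_div_factorial, Finset.sum_mul]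
    exact Finset.sum_congr rfl fun i _ => by ring
  · rw [Finset.mul_sum]
    exact Finset.sum_congr rfl fun i _ => by ring

/-- Kummer's transformation at a positive integer: `₁F₁(k + 1; 1; y)` is `eʸ` times a polynomial
of degree `k` (a Laguerre polynomial at `-y`). -/
lemma kummer_nat (k : ℕ) (y : ℝ) :
    kummer ((k : ℝ) + 1) 1 y
      = Real.exp y * ∑ i ∈ Finset.range (k + 1), (k.choose i : ℝ) * (y ^ i / i.factorial) :=
  (hasSum_kummer_nat k y).tsum_eq

lemma kummer_term_nonneg {m y : ℝ} (hm : 0 < m) (hy : 0 ≤ y) (n : ℕ) :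
    0 ≤ (ascPochhammer ℝ n).eval m / (ascPochhammer ℝ n).eval 1 * (y ^ n / (n.factorial : ℝ)) := by
  have := ascPochhammer_eval_nonneg hm n
  have := ascPochhammer_eval_nonneg one_pos n
  positivity

lemma kummer_term_le {m y : ℝ} (hm : 0 < m) (hy : 0 ≤ y) {k : ℕ} (hk : m ≤ k + 1) (n : ℕ) :
    (ascPochhammer ℝ n).eval m / (ascPochhammer ℝ n).eval 1 * (y ^ n / (n.factorial : ℝ))
      ≤ (ascPochhammer ℝ n).eval ((k : ℝ) + 1) / (ascPochhammer ℝ n).eval 1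
        * (y ^ n / (n.factorial : ℝ)) := by
  have := ascPochhammer_eval_mono hm hk n
  have := ascPochhammer_eval_nonneg one_pos n
  gcongr

lemma summable_kummer {m y : ℝ} (hm : 0 < m) (hy : 0 ≤ y) :
    Summable (fun n : ℕ => (ascPochhammer ℝ n).eval m / (ascPochhammer ℝ n).eval 1
        * (y ^ n / (n.factorial : ℝ))) := by
  obtain ⟨k, hk⟩ := exists_nat_ge m
  exact Summable.of_nonneg_of_le (kummer_term_nonneg hm hy)
    (kummer_term_le hm hy (k := k) (by linarith)) (hasSum_kummer_nat k y).summable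

lemma kummer_nonneg {m y : ℝ} (hm : 0 < m) (hy : 0 ≤ y) : 0 ≤ kummer m 1 y :=
  tsum_nonneg (kummer_term_nonneg hm hy)

lemma kummer_le {m y : ℝ} (hm : 0 < m) (hy : 0 ≤ y) {k : ℕ} (hk : m ≤ k + 1) :
    kummer m 1 y
      ≤ Real.exp y * ∑ i ∈ Finset.range (k + 1), (k.choose i : ℝ) * (y ^ i / i.factorial) := by
  rw [← kummer_nat]
  exact (summable_kummer hm hy).tsum_le_tsum (kummer_term_le hm hy hk)
    (hasSum_kummer_nat k y).summable

lemma kummer_zero (m : ℝ) : kummer m 1 0 = 1 := by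
  rw [kummer, tsum_eq_single 0]
  · simp
  · intro n hn; simp [hn]

lemma summable_kummer_all {m : ℝ} (hm : 0 < m) (y : ℝ) :
    Summable (fun n : ℕ => (ascPochhammer ℝ n).eval m / (ascPochhammer ℝ n).eval 1
        * (y ^ n / (n.factorial : ℝ))) := by
  refine Summable.of_norm ?_
  convert summable_kummer hm (abs_nonneg y) using 2 with n
  have := ascPochhammer_eval_nonneg hm n
  have := ascPochhammer_eval_nonneg one_pos n
  simp only [norm_mul, norm_div, norm_pow, Real.norm_eq_abs, abs_of_nonneg, *, Nat.abs_cast]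

lemma measurable_kummer {m : ℝ} (hm : 0 < m) : Measurable (fun y => kummer m 1 y) := by
  refine measurable_of_tendsto_metrizable (f := fun (N : ℕ) (y : ℝ) => ∑ n ∈ Finset.range N,
    (ascPochhammer ℝ n).eval m / (ascPochhammer ℝ n).eval 1 * (y ^ n / (n.factorial : ℝ)))
    (fun N => by fun_prop) ?_
  rw [tendsto_pi_nhds]
  exact fun y => (summable_kummer_all hm y).hasSum.tendsto_sum_nat

/-! ### Absolute convergence of the integral form -/

/-- In terms of the conditional variance `s = ω₁² + ω₂² x = 1 - β - α (1 - x)` of the Gaussian part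
of the signal, the integrand is a Rician shadowed density times `e⁻ˣ`. -/
lemma pdfIntegrand_eq {α β m γbar u x s : ℝ} (hm : 0 < m) (hγ : 0 < γbar) (hβ : 0 ≤ β)
    (hs : 0 < s) (hsx : s = 1 - β - α * (1 - x)) :
    pdfIntegrand α β m γbar u x
      = m ^ m * s ^ (m - 1) / (m * s + β) ^ m / γbar * Real.exp (-(u / (s * γbar))) * Real.exp (-x)
        * kummer m 1 (β * u / (s * γbar * (m * s + β))) := by
  have hK : ricianK α β x = β / s := by rw [ricianK, hsx]
  have hA : avgSNR α γbar x = γbar * (s + β) := by rw [avgSNR, hsx]; ring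
  have hd : 0 < m * s + β := by positivity
  have hsβ : 0 < s + β := by positivity
  have h1 : (m + β / s) ^ m = (m * s + β) ^ m / (s ^ (m - 1) * s) := by
    have : m + β / s = (m * s + β) / s := by field_simp
    rw [this, Real.div_rpow hd.le hs.le, Real.rpow_sub_one hs.ne', div_mul_cancel₀ _ hs.ne']
  have h2 : (1 + β / s) / (γbar * (s + β)) * u = u / (s * γbar) := by
    field_simp
  have h3 : β / s * (1 + β / s) / (β / s + m) * (u / (γbar * (s + β)))
      = β * u / (s * γbar * (m * s + β)) := by
    have : β / s + m = (m * s + β) / s := by field_simp; ring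
    rw [this]
    field_simp
  rw [pdfIntegrand, hK, hA, h3, sub_eq_add_neg, Real.exp_add, neg_mul, h2, h1,
    mul_assoc _ _ (Real.exp (-x))]
  have hp : 0 < s ^ (m - 1) := Real.rpow_pos_of_pos hs _
  have hq : 0 < (m * s + β) ^ m := Real.rpow_pos_of_pos hd _
  congr 1
  congr 1
  field_simp

lemma pdfIntegrand_nonneg {α β m γbar u x : ℝ} (hm : 0 < m) (hγ : 0 < γbar) (hβ : 0 ≤ β)
    (hs : 0 < 1 - β - α * (1 - x)) (hu : 0 ≤ u) : 0 ≤ pdfIntegrand α β m γbar u x := by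
  rw [pdfIntegrand_eq hm hγ hβ hs rfl]
  set s := 1 - β - α * (1 - x)
  have := kummer_nonneg hm (y := β * u / (s * γbar * (m * s + β))) (by positivity)
  positivity

lemma measurable_pdfIntegrand (α β γbar : ℝ) {m : ℝ} (hm : 0 < m) :
    Measurable (fun p : ℝ × ℝ => pdfIntegrand α β m γbar p.1 p.2) := by
  unfold pdfIntegrand ricianK avgSNR
  refine Measurable.mul (by fun_prop) ((measurable_kummer hm).comp (by fun_prop))

lemma integrableOn_rpow_mul_exp_neg {p : ℝ} (hp : -1 < p) :
    IntegrableOn (fun x : ℝ => x ^ p * Real.exp (-x)) (Set.Ioi 0) := by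
  have := Real.GammaIntegral_convergent (s := p + 1) (by linarith)
  simpa [mul_comm] using this

lemma integrableOn_exp_neg : IntegrableOn (fun x : ℝ => Real.exp (-x)) (Set.Ioi 0) := by
  simpa using integrableOn_rpow_mul_exp_neg (p := 0) (by norm_num)

lemma integrableOn_affine_rpow_mul_exp_neg {p c a : ℝ} (hp : -1 < p) (hc : 0 ≤ c) (ha : 0 ≤ a)
    (hca : 0 < c + a) :
    IntegrableOn (fun x : ℝ => (c + a * x) ^ p * Real.exp (-x)) (Set.Ioi 0) := by
  rcases ha.eq_or_lt with rfl | ha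
  · simpa [IntegrableOn] using integrableOn_exp_neg.const_mul (c ^ p)
  have hdom : IntegrableOn (fun x : ℝ => ((2 * c) ^ p + (2 * a) ^ p * x ^ p + a ^ p * x ^ p)
      * Real.exp (-x)) (Set.Ioi 0) := by
    have h1 := integrableOn_exp_neg.const_mul ((2 * c) ^ p)
    have h2 := (integrableOn_rpow_mul_exp_neg hp).const_mul ((2 * a) ^ p)
    have h3 := (integrableOn_rpow_mul_exp_neg hp).const_mul (a ^ p)
    refine ((h1.add h2).add h3).congr (ae_of_all _ fun x => ?_)
    simp only [Pi.add_apply]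
    ring
  refine hdom.mono' (by fun_prop) ?_
  refine (ae_restrict_iff' measurableSet_Ioi).2 (ae_of_all _ fun x hx => ?_)
  have hx : 0 < x := hx
  have hax : 0 < a * x := by positivity
  rw [Real.norm_of_nonneg (by positivity)]
  gcongr
  have n1 : 0 ≤ (2 * c) ^ p := by positivity
  have n2 : 0 ≤ (2 * a) ^ p * x ^ p := by positivity
  have n3 : 0 ≤ a ^ p * x ^ p := by positivity
  rcases le_total p 0 with hp0 | hp0
  · have : (c + a * x) ^ p ≤ (a * x) ^ p := Real.rpow_le_rpow_of_nonpos hax (by linarith) hp0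
    rw [Real.mul_rpow ha.le hx.le] at this
    linarith
  · rcases le_total c (a * x) with h | h
    · have : (c + a * x) ^ p ≤ (2 * a * x) ^ p :=
        Real.rpow_le_rpow (by positivity) (by linarith) hp0
      rw [Real.mul_rpow (by positivity) hx.le] at this
      linarith
    · have : (c + a * x) ^ p ≤ (2 * c) ^ p :=
        Real.rpow_le_rpow (by positivity) (by linarith) hp0
      linarith

/-- The conditional variance `1 - β - α (1 - x)` may vanish at `x = 0`. Bounding `₁F₁(m; 1; ·)` by
`₁F₁(⌈m⌉; 1; ·)` shows that the integrand is at most a combination of powers of this variance with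
exponents `m - 1 - i`, `i < ⌈m⌉`, all of which exceed `-1`. -/
lemma integrableOn_pdfIntegrand {α β m γbar u : ℝ} (hm : 0 < m) (hγ : 0 < γbar) (hα : 0 ≤ α)
    (hβ : 0 ≤ β) (hβ1 : β < 1) (hαβ : α + β ≤ 1) (hu : 0 < u) :
    IntegrableOn (fun x => pdfIntegrand α β m γbar u x) (Set.Ioi 0) := by
  have hmeas : AEStronglyMeasurable (fun x => pdfIntegrand α β m γbar u x)
      (volume.restrict (Set.Ioi 0)) :=
    ((measurable_pdfIntegrand α β γbar hm).comp
      (measurable_const.prodMk measurable_id)).aestronglyMeasurable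
  have hspos : ∀ x : ℝ, 0 < x → 0 < 1 - β - α * (1 - x) := fun x hx => by
    rcases hα.eq_or_lt with rfl | hα
    · linarith
    · nlinarith [mul_pos hα hx]
  rcases hβ.eq_or_lt with rfl | hβ
  -- for `β = 0` the integrand is `q e^{-u q} e⁻ˣ` with `q = 1 / (s γbar)`, and `q e^{-u q} ≤ 1 / u`
  · refine (integrableOn_exp_neg.const_mul (1 / u)).mono' hmeas ?_
    refine (ae_restrict_iff' measurableSet_Ioi).2 (ae_of_all _ fun x hx => ?_)
    have hs := hspos x hx
    rw [Real.norm_of_nonneg (pdfIntegrand_nonneg hm hγ le_rfl hs hu.le),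
      pdfIntegrand_eq hm hγ le_rfl hs rfl]
    set s := 1 - 0 - α * (1 - x)
    rw [zero_mul, zero_div, kummer_zero, mul_one, add_zero, Real.mul_rpow hm.le hs.le,
      Real.rpow_sub_one hs.ne']
    have h1 : 0 < m ^ m := by positivity
    have h2 : 0 < s ^ m := by positivity
    gcongr
    have h3 : m ^ m * (s ^ m / s) / (m ^ m * s ^ m) / γbar = 1 / u * (u / (s * γbar)) := by
      field_simp
    rw [h3, mul_assoc]
    have h4 := Real.add_one_le_exp (u / (s * γbar))
    have h5 : u / (s * γbar) * Real.exp (-(u / (s * γbar))) ≤ 1 := by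
      rw [Real.exp_neg, ← div_eq_mul_inv, div_le_one (Real.exp_pos _)]
      linarith
    calc 1 / u * (u / (s * γbar) * Real.exp (-(u / (s * γbar)))) ≤ 1 / u * 1 := by gcongr
      _ = 1 / u := mul_one _
  · obtain ⟨k, hk⟩ : ∃ k : ℕ, ⌈m⌉₊ = k + 1 :=
      Nat.exists_eq_succ_of_ne_zero (Nat.ceil_pos.2 hm).ne'
    have hkm : m ≤ k + 1 := by exact_mod_cast hk ▸ Nat.le_ceil m
    have hkm' : (k : ℝ) < m := by
      have := Nat.ceil_lt_add_one hm.le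
      rw [hk] at this
      push_cast at this
      linarith
    have hdom : IntegrableOn (fun x : ℝ => ∑ i ∈ Finset.range (k + 1),
        m ^ m / β ^ m / γbar * ((k.choose i : ℝ) * ((u / γbar) ^ i / i.factorial))
          * ((1 - β - α + α * x) ^ (m - 1 - i) * Real.exp (-x))) (Set.Ioi 0) := by
      refine integrable_finsetSum _ fun i hi => ?_
      have hi : (i : ℝ) ≤ k := by exact_mod_cast Nat.lt_succ_iff.1 (Finset.mem_range.1 hi)
      exact (integrableOn_affine_rpow_mul_exp_neg (by linarith) (by linarith) hα
        (by linarith)).const_mul _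
    refine hdom.mono' hmeas ?_
    refine (ae_restrict_iff' measurableSet_Ioi).2 (ae_of_all _ fun x hx => ?_)
    have hs := hspos x hx
    rw [Real.norm_of_nonneg (pdfIntegrand_nonneg hm hγ hβ.le hs hu.le),
      pdfIntegrand_eq hm hγ hβ.le hs rfl]
    have hsx : 1 - β - α + α * x = 1 - β - α * (1 - x) := by ring
    rw [hsx]
    set s := 1 - β - α * (1 - x)
    set y := β * u / (s * γbar * (m * s + β)) with hy
    have hy0 : 0 ≤ y := by positivity
    have hyle : y ≤ u / (s * γbar) := by
      have : y = u / (s * γbar) * (β / (m * s + β)) := by rw [hy]; field_simp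
      rw [this]
      refine mul_le_of_le_one_right (by positivity) ((div_le_one (by positivity)).2 ?_)
      have : 0 < m * s := by positivity
      linarith
    have hexp : Real.exp (-(u / (s * γbar))) * Real.exp y ≤ 1 := by
      rw [← Real.exp_add, Real.exp_le_one_iff]
      linarith
    calc m ^ m * s ^ (m - 1) / (m * s + β) ^ m / γbar * Real.exp (-(u / (s * γbar)))
          * Real.exp (-x) * kummer m 1 y
        ≤ m ^ m * s ^ (m - 1) / (m * s + β) ^ m / γbar * Real.exp (-(u / (s * γbar)))
          * Real.exp (-x)
          * (Real.exp y
            * ∑ i ∈ Finset.range (k + 1), (k.choose i : ℝ) * (y ^ i / i.factorial)) := by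
          gcongr
          exact kummer_le hm hy0 hkm
      _ = m ^ m * s ^ (m - 1) / (m * s + β) ^ m / γbar
          * (Real.exp (-(u / (s * γbar))) * Real.exp y) * Real.exp (-x)
          * ∑ i ∈ Finset.range (k + 1), (k.choose i : ℝ) * (y ^ i / i.factorial) := by ring
      _ ≤ m ^ m * s ^ (m - 1) / β ^ m / γbar * 1 * Real.exp (-x)
          * ∑ i ∈ Finset.range (k + 1),
            (k.choose i : ℝ) * ((u / (s * γbar)) ^ i / i.factorial) := by
          gcongr
          have : 0 < m * s := by positivity
          linarith
      _ = _ := by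
          rw [Finset.mul_sum]
          refine Finset.sum_congr rfl fun i _ => ?_
          rw [Real.rpow_sub hs (m - 1), Real.rpow_natCast, div_pow, div_pow, mul_pow]
          field_simp

/-! ### The finite sum at integer shape -/

lemma integrableOn_genGammaIntegrand (a : ℝ) {z b : ℝ} (hz : 0 ≤ z) (hb : 0 < b) :
    IntegrableOn (fun t => genGammaIntegrand a b t) (Set.Ioi z) := by
  refine IntegrableOn.mono_set ?_ (Set.Ioi_subset_Ioi hz)
  -- `e^{-b/t} ≤ N! (t/b)ᴺ` tames the power of `t` at zero
  obtain ⟨N, hN⟩ := exists_nat_gt (-a)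
  have hdom := (integrableOn_rpow_mul_exp_neg (p := a - 1 + N) (by linarith)).const_mul
    ((N.factorial : ℝ) / b ^ N)
  refine hdom.mono' ?_ ?_
  · unfold genGammaIntegrand
    exact Measurable.aestronglyMeasurable (by fun_prop)
  refine (ae_restrict_iff' measurableSet_Ioi).2 (ae_of_all _ fun t ht => ?_)
  have ht : 0 < t := ht
  unfold genGammaIntegrand
  rw [Real.norm_of_nonneg (by positivity), Real.rpow_add ht, Real.rpow_natCast]
  have h1 : Real.exp (-b / t) ≤ (N.factorial : ℝ) / b ^ N * t ^ N := by
    have h2 := Real.pow_div_factorial_le_exp (b / t) (div_pos hb ht).le N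
    rw [neg_div, Real.exp_neg]
    calc (Real.exp (b / t))⁻¹ ≤ ((b / t) ^ N / N.factorial)⁻¹ :=
          inv_anti₀ (by positivity) h2
      _ = _ := by rw [div_pow]; field_simp
  calc t ^ (a - 1) * Real.exp (-t) * Real.exp (-b / t)
      ≤ t ^ (a - 1) * Real.exp (-t) * ((N.factorial : ℝ) / b ^ N * t ^ N) := by gcongr
    _ = _ := by ring

lemma lowerLimit_nonneg {α β : ℝ} {n : ℕ} (hα : 0 ≤ α) (hβ : 0 ≤ β) (hαβ : α + β ≤ 1) :
    0 ≤ lowerLimit α β n := by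
  have : 0 ≤ 1 - α - β := by linarith
  unfold lowerLimit
  positivity

/-- One summand of the polynomial factor of `₁F₁(n; 1; ·)`, in the variable `t = x + z` in which the
conditional variance is `α t - β / n`: the power of that variance is expanded by the binomial
theorem. -/
lemma finite_sum_summand {α β γbar u t w : ℝ} {i j : ℕ} (hγ : 0 < γbar) (hα : 0 < α)
    (ht : 0 < t) (hs : 0 < α * t - β / ((i + j + 1 : ℕ) : ℝ)) :
    ((i + j + 1 : ℕ) : ℝ) ^ (i + j + 1) * (α * t - β / ((i + j + 1 : ℕ) : ℝ)) ^ (i + j)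
        / (((i + j + 1 : ℕ) : ℝ) * α * t) ^ (i + j + 1) / γbar
        * (Real.exp w * (Real.exp (-t) * Real.exp (-(u / (α * γbar)) / t)))
        * (((i + j).choose i : ℝ) * ((β * u / ((α * t - β / ((i + j + 1 : ℕ) : ℝ)) * γbar
          * (((i + j + 1 : ℕ) : ℝ) * α * t))) ^ i / i.factorial))
      = ((i + j).choose j : ℝ)
      * (u ^ i * Real.exp w * (β / ((i + j + 1 : ℕ) : ℝ)) ^ i
        / (γbar ^ (i + 1) * (i.factorial : ℝ) * α ^ (i + j + 1 + i)))
      * ∑ r ∈ Finset.range (j + 1),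
          (j.choose r : ℝ) * (-β / ((i + j + 1 : ℕ) : ℝ)) ^ (j - r) * α ^ r
            * genGammaIntegrand ((r : ℝ) - 2 * ((i + j + 1 : ℕ) : ℝ) + j + 2)
              (u / (α * γbar)) t := by
  have hsum : ∑ r ∈ Finset.range (j + 1),
          (j.choose r : ℝ) * (-β / ((i + j + 1 : ℕ) : ℝ)) ^ (j - r) * α ^ r
            * genGammaIntegrand ((r : ℝ) - 2 * ((i + j + 1 : ℕ) : ℝ) + j + 2)
              (u / (α * γbar)) t
      = (α * t - β / ((i + j + 1 : ℕ) : ℝ)) ^ j / t ^ (i + j + 1 + i)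
        * (Real.exp (-t) * Real.exp (-(u / (α * γbar)) / t)) := by
    rw [sub_eq_add_neg, add_pow, Finset.sum_div, Finset.sum_mul]
    refine Finset.sum_congr rfl fun r _ => ?_
    have he : (r : ℝ) - 2 * ((i + j + 1 : ℕ) : ℝ) + j + 2 - 1
        = (r : ℝ) - ((i + j + 1 + i : ℕ) : ℝ) := by
      push_cast; ring
    rw [genGammaIntegrand, he, Real.rpow_sub ht, Real.rpow_natCast, Real.rpow_natCast, mul_pow,
      neg_div]
    ring
  rw [hsum, Nat.choose_symm_add]
  have hn : (((i + j + 1 : ℕ) : ℝ)) ≠ 0 := by positivity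
  generalize (((i + j + 1 : ℕ) : ℝ)) = n at *
  generalize hS : α * t - β / n = s at *
  have hs' : s ≠ 0 := hs.ne'
  have hf : (i.factorial : ℝ) ≠ 0 := by positivity
  generalize Real.exp (-t) * Real.exp (-(u / (α * γbar)) / t) = E
  simp only [div_pow, mul_pow, pow_add, pow_one]
  field_simp

/-- At integer shape Kummer's transformation makes the integrand elementary; `n s + β` is
proportional to `t = x + z`, where `s` is the conditional variance at `x` and `z` is `lowerLimit α β n`. -/
lemma pdfIntegrand_eq_sum {α β γbar u x : ℝ} {k : ℕ} (hγ : 0 < γbar) (hα : 0 < α)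
    (hβ : 0 ≤ β) (hαβ : α + β ≤ 1) (hx : 0 < x) :
    pdfIntegrand α β ((k + 1 : ℕ) : ℝ) γbar u x
      = ∑ j ∈ Finset.range (k + 1),
        (k.choose j : ℝ)
        * (u ^ (k + 1 - j - 1) * Real.exp (lowerLimit α β (k + 1))
            * (β / ((k + 1 : ℕ) : ℝ)) ^ (k + 1 - j - 1)
          / (γbar ^ (k + 1 - j) * ((k + 1 - j - 1).factorial : ℝ) * α ^ (2 * (k + 1) - j - 1)))
        * ∑ r ∈ Finset.range (j + 1),
            (j.choose r : ℝ) * (-β / ((k + 1 : ℕ) : ℝ)) ^ (j - r) * α ^ r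
              * genGammaIntegrand ((r : ℝ) - 2 * ((k + 1 : ℕ) : ℝ) + j + 2)
                (u / (α * γbar)) (x + lowerLimit α β (k + 1)) := by
  set z := lowerLimit α β (k + 1) with hz
  have hz0 : 0 ≤ z := lowerLimit_nonneg hα.le hβ hαβ
  have hn : (0 : ℝ) < ((k + 1 : ℕ) : ℝ) := by positivity
  have hs : 0 < 1 - β - α * (1 - x) := by nlinarith [mul_pos hα hx]
  have ht : 0 < x + z := by positivity
  have hst : α * (x + z) - β / ((k + 1 : ℕ) : ℝ) = 1 - β - α * (1 - x) := by
    rw [hz, lowerLimit]; field_simp; ring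
  have hdt : ((k + 1 : ℕ) : ℝ) * (1 - β - α * (1 - x)) + β = ((k + 1 : ℕ) : ℝ) * α * (x + z) := by
    rw [← hst]; field_simp; ring
  have hk1 : ((k + 1 : ℕ) : ℝ) - 1 = (k : ℝ) := by push_cast; ring
  have hkum : ∀ y, kummer ((k + 1 : ℕ) : ℝ) 1 y
      = Real.exp y * ∑ i ∈ Finset.range (k + 1), (k.choose i : ℝ) * (y ^ i / i.factorial) := by
    intro y; rw [← kummer_nat]; push_cast; rfl
  rw [pdfIntegrand_eq hn hγ hβ hs rfl, hkum, hdt, hk1, Real.rpow_natCast, Real.rpow_natCast,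
    Real.rpow_natCast, ← hst]
  -- the exponential of Kummer's transformation combines with the other two
  have hexp : Real.exp (-(u / ((α * (x + z) - β / ((k + 1 : ℕ) : ℝ)) * γbar))) * Real.exp (-x)
      * Real.exp (β * u / ((α * (x + z) - β / ((k + 1 : ℕ) : ℝ)) * γbar
          * (((k + 1 : ℕ) : ℝ) * α * (x + z))))
      = Real.exp z * (Real.exp (-(x + z)) * Real.exp (-(u / (α * γbar)) / (x + z))) := by
    simp only [← Real.exp_add]
    congr 1
    have hs' : α * (x + z) - β / ((k + 1 : ℕ) : ℝ) ≠ 0 := by rw [hst]; exact hs.ne'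
    generalize hS : α * (x + z) - β / ((k + 1 : ℕ) : ℝ) = s at *
    have hb : β = ((k + 1 : ℕ) : ℝ) * (α * (x + z) - s) := by rw [← hS]; field_simp; ring
    rw [hb]
    field_simp
    ring
  rw [← mul_assoc, mul_assoc _ (Real.exp (-(u / _))) (Real.exp (-x)), mul_assoc _ _ (Real.exp _),
    hexp, Finset.mul_sum, ← Finset.sum_range_reflect]
  refine Finset.sum_congr rfl fun j hj => ?_
  obtain ⟨i, rfl⟩ : ∃ i, k = i + j :=
    ⟨k - j, (Nat.sub_add_cancel (Nat.lt_succ_iff.1 (Finset.mem_range.1 hj))).symm⟩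
  have e1 : i + j + 1 - 1 - j = i := by omega
  have e2 : i + j + 1 - j - 1 = i := by omega
  have e3 : i + j + 1 - j = i + 1 := by omega
  have e4 : 2 * (i + j + 1) - j - 1 = i + j + 1 + i := by omega
  rw [e1, e2, e3, e4]
  exact finite_sum_summand hγ hα ht (by rw [hst]; exact hs)

/-- The substitution `t = x + z` turns the integral form into a combination of generalized
incomplete gamma functions. -/
lemma pdfIntegral_eq_pdfSum {α β γbar u : ℝ} {n : ℕ} (hn : 0 < n) (hγ : 0 < γbar) (hα : 0 < α)
    (hβ : 0 ≤ β) (hαβ : α + β ≤ 1) (hu : 0 < u) :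
    pdfIntegral α β n γbar u = pdfSum α β n γbar u := by
  obtain ⟨k, rfl⟩ : ∃ k, n = k + 1 := Nat.exists_eq_succ_of_ne_zero hn.ne'
  have hb : 0 < u / (α * γbar) := by positivity
  have hz0 : 0 ≤ lowerLimit α β (k + 1) := lowerLimit_nonneg hα.le hβ hαβ
  have hint : ∀ a, IntegrableOn (fun x => genGammaIntegrand a (u / (α * γbar))
      (x + lowerLimit α β (k + 1))) (Set.Ioi 0) := fun a => by
    have := integrableOn_genGammaIntegrand a hz0 hb
    have h2 := (measurePreserving_add_right volume
      (lowerLimit α β (k + 1))).integrableOn_comp_preimage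
      (measurableEmbedding_addRight _) (s := Set.Ioi (lowerLimit α β (k + 1)))
      (f := fun t => genGammaIntegrand a (u / (α * γbar)) t)
    simpa [Function.comp_def] using h2.2 this
  have hval : ∀ a, ∫ x in Set.Ioi 0, genGammaIntegrand a (u / (α * γbar))
      (x + lowerLimit α β (k + 1)) = genGamma a (lowerLimit α β (k + 1)) (u / (α * γbar)) :=
    fun a => by
    have h2 := (measurePreserving_add_right volume
      (lowerLimit α β (k + 1))).setIntegral_preimage_emb
      (measurableEmbedding_addRight _) (fun t => genGammaIntegrand a (u / (α * γbar)) t)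
      (Set.Ioi (lowerLimit α β (k + 1)))
    simpa [genGamma] using h2
  rw [pdfIntegral, setIntegral_congr_fun measurableSet_Ioi
    fun x hx => pdfIntegrand_eq_sum hγ hα hβ hαβ hx, integral_finsetSum, pdfSum]
  · refine Finset.sum_congr rfl fun j _ => ?_
    rw [integral_const_mul, integral_finsetSum]
    · simp only [integral_const_mul, hval, Nat.add_sub_cancel]
    · exact fun r _ => (hint _).const_mul _
  · exact fun j _ => (integrable_finsetSum _ fun r _ => (hint _).const_mul _).const_mul _

open scoped ENNReal

/-! ### The circularly symmetric complex normal law -/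

instance isProbabilityMeasure_complexNormal (μ : ℂ) (v : ℝ≥0) :
    IsProbabilityMeasure (complexNormal μ v) := by
  unfold complexNormal
  exact Measure.isProbabilityMeasure_map
    (Complex.measurableEquivRealProd.symm.measurable.aemeasurable)

instance isProbabilityMeasure_uniformPhase : IsProbabilityMeasure uniformPhase := by
  unfold uniformPhase
  refine ProbabilityTheory.cond_isProbabilityMeasure_of_finite ?_ ?_
  · simp [Real.pi_pos]
  · rw [Real.volume_Ico]
    exact ENNReal.ofReal_ne_top

lemma complexNormal_eq_map (v : ℝ≥0) :
    complexNormal 0 v = ((gaussianReal 0 (v / 2)).prod (gaussianReal 0 (v / 2))).map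
      Complex.measurableEquivRealProd.symm := rfl

lemma charFun_complexNormal (v : ℝ≥0) (t : ℂ) :
    charFun (complexNormal 0 v) t = Complex.exp (-((v : ℝ) * ‖t‖ ^ 2 / 4 : ℝ)) := by
  rw [charFun_apply, complexNormal_eq_map, integral_map_equiv]
  have h : ∀ p : ℝ × ℝ, Complex.exp (inner ℝ (Complex.measurableEquivRealProd.symm p) t * Complex.I)
      = Complex.exp (t.re * p.1 * Complex.I) * Complex.exp (t.im * p.2 * Complex.I) := fun p => by
    rw [← Complex.exp_add]
    congr 1
    simp [Complex.inner, Complex.measurableEquivRealProd_symm_apply]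
    ring
  simp_rw [h]
  rw [integral_prod_mul (fun x : ℝ => Complex.exp (t.re * x * Complex.I))
    (fun x : ℝ => Complex.exp (t.im * x * Complex.I)), ← charFun_apply_real, ← charFun_apply_real,
    charFun_gaussianReal, charFun_gaussianReal, ← Complex.exp_add, Complex.sq_norm,
    Complex.normSq_apply]
  congr 1
  push_cast
  ring

/-- A linear combination of independent standard complex normal variables is complex normal. -/
lemma map_linear_complexNormal (c d : ℂ) (v : ℝ≥0) (hv : (v : ℝ) = ‖c‖ ^ 2 + ‖d‖ ^ 2) :
    ((complexNormal 0 1).prod (complexNormal 0 1)).map (fun p : ℂ × ℂ => c * p.1 + d * p.2)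
      = complexNormal 0 v := by
  have hmeas : Measurable (fun p : ℂ × ℂ => c * p.1 + d * p.2) := by fun_prop
  have : IsProbabilityMeasure (((complexNormal 0 1).prod (complexNormal 0 1)).map
      (fun p : ℂ × ℂ => c * p.1 + d * p.2)) := Measure.isProbabilityMeasure_map hmeas.aemeasurable
  refine Measure.ext_of_charFun ?_
  ext t
  rw [charFun_complexNormal, charFun_apply, integral_map hmeas.aemeasurable (by fun_prop)]
  have h : ∀ p : ℂ × ℂ, Complex.exp (inner ℝ (c * p.1 + d * p.2) t * Complex.I)
      = Complex.exp (inner ℝ p.1 ((starRingEnd ℂ) c * t) * Complex.I)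
        * Complex.exp (inner ℝ p.2 ((starRingEnd ℂ) d * t) * Complex.I) := fun p => by
    rw [← Complex.exp_add]
    congr 1
    simp [Complex.inner]
    ring
  simp_rw [h]
  rw [integral_prod_mul (fun x : ℂ => Complex.exp (inner ℝ x ((starRingEnd ℂ) c * t) * Complex.I))
    (fun x : ℂ => Complex.exp (inner ℝ x ((starRingEnd ℂ) d * t) * Complex.I)),
    ← charFun_apply, ← charFun_apply, charFun_complexNormal, charFun_complexNormal,
    ← Complex.exp_add]
  congr 1
  rw [hv, norm_mul, norm_mul, RCLike.norm_conj, RCLike.norm_conj]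
  push_cast
  ring

lemma complexNormal_eq_withDensity {v : ℝ≥0} (hv : v ≠ 0) :
    complexNormal 0 v = volume.withDensity
      (fun z : ℂ => ENNReal.ofReal (1 / (Real.pi * v) * Real.exp (-(‖z‖ ^ 2) / v))) := by
  have hv2 : v / 2 ≠ 0 := by positivity
  have hv0 : (0 : ℝ) < v := by positivity
  rw [complexNormal_eq_map, gaussianReal_of_var_ne_zero _ hv2,
    prod_withDensity (measurable_gaussianPDF _ _) (measurable_gaussianPDF _ _)]
  refine Measure.ext_of_lintegral _ fun f hf => ?_
  have hd : ∀ p : ℝ × ℝ, gaussianPDF 0 (v / 2) p.1 * gaussianPDF 0 (v / 2) p.2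
      = ENNReal.ofReal (1 / (Real.pi * v)
        * Real.exp (-(‖Complex.measurableEquivRealProd.symm p‖ ^ 2) / v)) := fun p => by
    rw [gaussianPDF, gaussianPDF, ← ENNReal.ofReal_mul (gaussianPDFReal_nonneg _ _ _),
      gaussianPDFReal, gaussianPDFReal, Complex.sq_norm, Complex.normSq_apply,
      Complex.measurableEquivRealProd_symm_apply]
    congr 1
    have hsq : (√(2 * Real.pi * ((v / 2 : ℝ≥0) : ℝ)))⁻¹ * (√(2 * Real.pi * ((v / 2 : ℝ≥0) : ℝ)))⁻¹
        = 1 / (Real.pi * v) := by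
      rw [← mul_inv, Real.mul_self_sqrt (by positivity)]
      push_cast
      field_simp
    rw [mul_mul_mul_comm, hsq, ← Real.exp_add]
    congr 2
    push_cast
    field_simp
    ring
  rw [lintegral_map_equiv, lintegral_withDensity_eq_lintegral_mul _ (by fun_prop) (by fun_prop),
    lintegral_withDensity_eq_lintegral_mul _ (by fun_prop) hf,
    ← Complex.volume_preserving_equiv_real_prod.symm.lintegral_comp_emb
      Complex.measurableEquivRealProd.symm.measurableEmbedding]
  simp only [Pi.mul_apply, hd]
  rfl

/-! ### The Rician density -/

/-- The value `I₀(2 √y)` of the modified Bessel function, as the series `∑ yⁿ / n!²`. The series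
is formed in `[0, ∞]`, where it needs no convergence argument. -/
noncomputable def besselSeries (y : ℝ) : ℝ≥0∞ :=
  ∑' n : ℕ, ENNReal.ofReal (y ^ n / (n.factorial : ℝ) ^ 2)

@[fun_prop]
lemma measurable_besselSeries : Measurable besselSeries := by
  unfold besselSeries
  exact Measurable.tsum fun n => by fun_prop

lemma besselSeries_zero : besselSeries 0 = 1 := by
  rw [besselSeries, tsum_eq_single 0]
  · simp
  · intro n hn; simp [hn]

lemma integral_cos_pow_two_pi (k : ℕ) :
    (∫ x in (0 : ℝ)..(2 * Real.pi), Real.cos x ^ (2 * k))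
        = 2 * Real.pi * ((2 * k).factorial / (4 ^ k * (k.factorial : ℝ) ^ 2))
      ∧ (∫ x in (0 : ℝ)..(2 * Real.pi), Real.cos x ^ (2 * k + 1)) = 0 := by
  induction k with
  | zero => simp
  | succ k ih =>
    rw [show 2 * (k + 1) = 2 * k + 2 by ring, show 2 * k + 2 + 1 = 2 * k + 1 + 2 by ring,
      integral_cos_pow, integral_cos_pow, ih.1, ih.2]
    refine ⟨?_, by simp⟩
    have h1 : (k.factorial : ℝ) ≠ 0 := by positivity
    have h2 : (k : ℝ) + 1 ≠ 0 := by positivity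
    rw [Nat.factorial_succ (2 * k + 1), Nat.factorial_succ (2 * k), Nat.factorial_succ k]
    push_cast
    simp only [Real.sin_two_pi, Real.sin_zero, mul_zero, sub_zero, zero_div, zero_add]
    field_simp
    ring

/-- The integral of the exponential series term by term; the odd powers of the cosine contribute
nothing. The sum is `2π I₀(2r)`. -/
lemma hasSum_integral_exp_cos (r : ℝ) :
    HasSum (fun k : ℕ => 2 * Real.pi * ((r ^ 2) ^ k / (k.factorial : ℝ) ^ 2))
      (∫ x in (0 : ℝ)..(2 * Real.pi), Real.exp (2 * r * Real.cos x)) := by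
  have h : HasSum (fun n : ℕ => ∫ x in (0 : ℝ)..(2 * Real.pi),
      (2 * r * Real.cos x) ^ n / (n.factorial : ℝ))
      (∫ x in (0 : ℝ)..(2 * Real.pi), Real.exp (2 * r * Real.cos x)) := by
    refine intervalIntegral.hasSum_integral_of_dominated_convergence
      (fun n _ => |2 * r| ^ n / (n.factorial : ℝ))
      (fun n => Measurable.aestronglyMeasurable (by fun_prop)) (fun n => ?_) ?_ ?_ ?_
    · refine ae_of_all _ fun x _ => ?_
      rw [norm_div, norm_pow, norm_mul, Real.norm_eq_abs, Real.norm_eq_abs,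
        Real.norm_of_nonneg (Nat.cast_nonneg _)]
      gcongr
      exact mul_le_of_le_one_right (abs_nonneg _) (Real.abs_cos_le_one x)
    · exact ae_of_all _ fun x _ => Real.summable_pow_div_factorial _
    · exact intervalIntegrable_const
    · refine ae_of_all _ fun x _ => ?_
      rw [Real.exp_eq_exp_ℝ]
      exact NormedSpace.expSeries_div_hasSum_exp _
  have hinj : Function.Injective (fun k : ℕ => 2 * k) := mul_right_injective₀ two_ne_zero
  rw [← hinj.hasSum_iff] at h
  · convert h using 2 with k
    simp only [Function.comp, mul_pow _ (Real.cos _), intervalIntegral.integral_div,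
      intervalIntegral.integral_const_mul, (integral_cos_pow_two_pi k).1]
    have h1 : ((2 * k).factorial : ℝ) ≠ 0 := by positivity
    rw [pow_mul (2 * r), mul_pow 2 r, mul_pow]
    norm_num
    field_simp
  · intro n hn
    obtain ⟨k, rfl⟩ : ∃ k, n = 2 * k + 1 := by
      rcases Nat.even_or_odd' n with ⟨k, rfl | rfl⟩
      · exact absurd ⟨k, rfl⟩ hn
      · exact ⟨k, rfl⟩
    simp only [mul_pow _ (Real.cos _), intervalIntegral.integral_div,
      intervalIntegral.integral_const_mul, (integral_cos_pow_two_pi k).2, mul_zero, zero_div]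

lemma lintegral_uniformPhase_exp_cos (r θ : ℝ) :
    ∫⁻ φ, ENNReal.ofReal (Real.exp (2 * r * Real.cos (θ - φ))) ∂uniformPhase
      = besselSeries (r ^ 2) := by
  have hpi : (0 : ℝ) < 2 * Real.pi := by positivity
  have hper : Function.Periodic (fun φ => Real.exp (2 * r * Real.cos φ)) (2 * Real.pi) :=
    fun φ => by simp
  have hval : ∫ φ in (0 : ℝ)..(2 * Real.pi), Real.exp (2 * r * Real.cos (θ - φ))
      = ∫ φ in (0 : ℝ)..(2 * Real.pi), Real.exp (2 * r * Real.cos φ) := by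
    rw [intervalIntegral.integral_comp_sub_left (fun φ => Real.exp (2 * r * Real.cos φ)) θ]
    have := hper.intervalIntegral_add_eq (θ - 2 * Real.pi) 0
    simpa using this
  have hint : IntegrableOn (fun φ => Real.exp (2 * r * Real.cos (θ - φ)))
      (Set.Ioc 0 (2 * Real.pi)) :=
    (Continuous.intervalIntegrable (by fun_prop) _ _).1
  rw [uniformPhase, ProbabilityTheory.cond, lintegral_smul_measure,
    setLIntegral_congr Ico_ae_eq_Ioc,
    ← ofReal_integral_eq_lintegral_ofReal hint (ae_of_all _ fun φ => (Real.exp_pos _).le),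
    ← intervalIntegral.integral_of_le hpi.le, hval, ← (hasSum_integral_exp_cos r).tsum_eq,
    tsum_mul_left, Real.volume_Ico, sub_zero, ENNReal.ofReal_mul hpi.le, smul_eq_mul, ← mul_assoc,
    ENNReal.inv_mul_cancel (ENNReal.ofReal_pos.2 hpi).ne' ENNReal.ofReal_ne_top,
    one_mul, besselSeries,
    ENNReal.ofReal_tsum_of_nonneg (fun n => by positivity)]
  have := (hasSum_integral_exp_cos r).summable
  exact (summable_mul_left_iff hpi.ne').1 this

lemma lintegral_comp_sq (g : ℝ → ℝ≥0∞) :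
    ∫⁻ r in Set.Ioi (0 : ℝ), ENNReal.ofReal (2 * r) * g (r ^ 2) = ∫⁻ v in Set.Ioi (0 : ℝ), g v := by
  have himg : (fun r : ℝ => r ^ 2) '' Set.Ioi 0 = Set.Ioi 0 := by
    ext v
    constructor
    · rintro ⟨r, hr, rfl⟩
      have hr : 0 < r := hr
      exact Set.mem_Ioi.2 (by positivity)
    · intro hv
      have hv : 0 < v := hv
      exact ⟨√v, Real.sqrt_pos.2 hv, Real.sq_sqrt hv.le⟩
  have hinj : Set.InjOn (fun r : ℝ => r ^ 2) (Set.Ioi 0) := fun a ha b hb hab =>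
    (pow_left_inj₀ (le_of_lt ha) (le_of_lt hb) two_ne_zero).1 hab
  have := lintegral_image_eq_lintegral_abs_deriv_mul (f := fun r : ℝ => r ^ 2)
    (f' := fun r => 2 * r) measurableSet_Ioi
    (fun x _ => by simpa using (hasDerivAt_pow 2 x).hasDerivWithinAt) hinj g
  rw [himg] at this
  rw [this]
  refine setLIntegral_congr_fun measurableSet_Ioi fun r hr => ?_
  have hr : 0 < r := hr
  simp only [abs_of_pos (mul_pos two_pos hr)]

lemma normSq_polar_sub (a r θ φ : ℝ) :
    ‖Complex.polarCoord.symm (r, θ) - (a : ℂ) * Complex.exp (Complex.I * (φ : ℂ))‖ ^ 2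
      = r ^ 2 + a ^ 2 - 2 * (a * r) * Real.cos (θ - φ) := by
  rw [Complex.sq_norm, Complex.normSq_apply, Complex.polarCoord_symm_apply, mul_comm Complex.I,
    Complex.exp_mul_I, ← Complex.ofReal_cos, ← Complex.ofReal_sin, Real.cos_sub]
  simp [-Complex.ofReal_cos, -Complex.ofReal_sin]
  nlinarith [Real.sin_sq_add_cos_sq θ, Real.sin_sq_add_cos_sq φ]

/-- The squared modulus of a constant-modulus component of amplitude `a` with uniform phase plus a
complex normal component of variance `s` has the Rician power density. -/
lemma lintegral_rice {s : ℝ≥0} (hs : s ≠ 0) (a : ℝ) {h : ℝ → ℝ≥0∞} (hh : Measurable h) :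
    ∫⁻ φ, ∫⁻ z, h (‖(a : ℂ) * Complex.exp (Complex.I * (φ : ℂ)) + z‖ ^ 2) ∂(complexNormal 0 s)
        ∂uniformPhase
      = ∫⁻ v in Set.Ioi (0 : ℝ), ENNReal.ofReal (1 / s * Real.exp (-(v + a ^ 2) / s))
          * besselSeries (a ^ 2 * v / s ^ 2) * h v := by
  have hs0 : (0 : ℝ) < s := by positivity
  have hsR : (s : ℝ) ≠ 0 := hs0.ne'
  have hstep : ∀ φ : ℝ,
      ∫⁻ z, h (‖(a : ℂ) * Complex.exp (Complex.I * (φ : ℂ)) + z‖ ^ 2) ∂(complexNormal 0 s)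
      = ∫⁻ p in polarCoord.target, ENNReal.ofReal p.1 * (ENNReal.ofReal (1 / (Real.pi * s)
          * Real.exp (-(p.1 ^ 2 + a ^ 2) / s)) * h (p.1 ^ 2))
          * ENNReal.ofReal (Real.exp (2 * (a * p.1 / s) * Real.cos (p.2 - φ))) := fun φ => by
    rw [complexNormal_eq_withDensity hs,
      lintegral_withDensity_eq_lintegral_mul _ (by fun_prop) (by fun_prop),
      ← lintegral_add_left_eq_self _ (-((a : ℂ) * Complex.exp (Complex.I * (φ : ℂ)))),
      ← Complex.lintegral_comp_polarCoord_symm]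
    refine setLIntegral_congr_fun polarCoord.open_target.measurableSet fun p hp => ?_
    have hr : 0 < p.1 := by
      rw [polarCoord_target] at hp
      exact hp.1
    simp only [Pi.mul_apply, smul_eq_mul, add_neg_cancel_left]
    rw [neg_add_eq_sub, normSq_polar_sub, Complex.norm_polarCoord_symm, sq_abs,
      show -(p.1 ^ 2 + a ^ 2 - 2 * (a * p.1) * Real.cos (p.2 - φ)) / (s : ℝ)
        = -(p.1 ^ 2 + a ^ 2) / s + 2 * (a * p.1 / s) * Real.cos (p.2 - φ) by ring,
      Real.exp_add, ← mul_assoc (1 / (Real.pi * (s : ℝ))), ENNReal.ofReal_mul (by positivity)]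
    ring
  simp_rw [hstep]
  rw [lintegral_lintegral_swap (by fun_prop)]
  have hstep2 : ∀ p : ℝ × ℝ, ∫⁻ φ, ENNReal.ofReal p.1 * (ENNReal.ofReal (1 / (Real.pi * s)
          * Real.exp (-(p.1 ^ 2 + a ^ 2) / s)) * h (p.1 ^ 2))
          * ENNReal.ofReal (Real.exp (2 * (a * p.1 / s) * Real.cos (p.2 - φ))) ∂uniformPhase
      = ENNReal.ofReal p.1 * (ENNReal.ofReal (1 / (Real.pi * s)
          * Real.exp (-(p.1 ^ 2 + a ^ 2) / s)) * h (p.1 ^ 2))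
          * besselSeries ((a * p.1 / s) ^ 2) := fun p => by
    rw [lintegral_const_mul _ (by fun_prop), lintegral_uniformPhase_exp_cos]
  simp_rw [hstep2]
  rw [polarCoord_target, Measure.volume_eq_prod, ← Measure.prod_restrict,
    lintegral_prod _ (by fun_prop)]
  refine Eq.trans ?_ (lintegral_comp_sq fun v =>
    ENNReal.ofReal (1 / s * Real.exp (-(v + a ^ 2) / s))
          * besselSeries (a ^ 2 * v / s ^ 2) * h v)
  refine setLIntegral_congr_fun measurableSet_Ioi fun r hr => ?_
  have hr : 0 < r := hr
  simp only [lintegral_const, Measure.restrict_apply_univ, Real.volume_Ioo]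
  rw [show (a * r / s) ^ 2 = a ^ 2 * r ^ 2 / (s : ℝ) ^ 2 by ring]
  have hc : ENNReal.ofReal r * ENNReal.ofReal (1 / (Real.pi * s) * Real.exp (-(r ^ 2 + a ^ 2) / s))
      * ENNReal.ofReal (Real.pi - -Real.pi)
      = ENNReal.ofReal (2 * r) * ENNReal.ofReal (1 / s * Real.exp (-(r ^ 2 + a ^ 2) / s)) := by
    rw [← ENNReal.ofReal_mul hr.le, ← ENNReal.ofReal_mul (by positivity),
      ← ENNReal.ofReal_mul (by positivity)]
    congr 1
    field_simp
    ring
  calc _ = (ENNReal.ofReal r * ENNReal.ofReal (1 / (Real.pi * s)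
            * Real.exp (-(r ^ 2 + a ^ 2) / s)) * ENNReal.ofReal (Real.pi - -Real.pi))
          * besselSeries (a ^ 2 * r ^ 2 / (s : ℝ) ^ 2) * h (r ^ 2) := by ring
    _ = _ := by rw [hc]; ring

/-- The squared modulus of a standard complex normal variable is exponentially distributed: the
Rician law with amplitude zero. -/
lemma lintegral_complexNormal_normSq {h : ℝ → ℝ≥0∞} (hh : Measurable h) :
    ∫⁻ z, h (‖z‖ ^ 2) ∂(complexNormal 0 1)
      = ∫⁻ x in Set.Ioi (0 : ℝ), ENNReal.ofReal (Real.exp (-x)) * h x := by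
  have := lintegral_rice one_ne_zero 0 hh
  simpa [besselSeries_zero] using this

/-! ### Averaging over the Gamma distributed power -/

lemma lintegral_gammaMeasure (m : ℝ) {f : ℝ → ℝ≥0∞} (hf : Measurable f) :
    ∫⁻ ξ, f ξ ∂(gammaMeasure m m)
      = ∫⁻ ξ in Set.Ioi (0 : ℝ), ENNReal.ofReal (m ^ m / Real.Gamma m * ξ ^ (m - 1)
          * Real.exp (-(m * ξ))) * f ξ := by
  rw [gammaMeasure, lintegral_withDensity_eq_lintegral_mul _ (f := gammaPDF m m)
    (measurable_gammaPDFReal m m).ennreal_ofReal hf, ← setLIntegral_eq_of_support_subset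
    (s := Set.Ici (0 : ℝ)) (fun ξ hξ => ?_), setLIntegral_congr Ioi_ae_eq_Ici.symm]
  · refine setLIntegral_congr_fun measurableSet_Ioi fun ξ hξ => ?_
    simp only [Pi.mul_apply]
    rw [gammaPDF_of_nonneg (le_of_lt hξ)]
  · by_contra hneg
    have : ξ < 0 := not_le.1 hneg
    simp [gammaPDF_of_neg this] at hξ

lemma Gamma_add_nat {m : ℝ} (hm : 0 < m) (n : ℕ) :
    Real.Gamma (m + n) = Real.Gamma m * (ascPochhammer ℝ n).eval m := by
  induction n with
  | zero => simp
  | succ n ih =>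
    rw [Nat.cast_succ, ← add_assoc, Real.Gamma_add_one (by positivity), ih,
      ascPochhammer_succ_eval]
    ring

lemma lintegral_rpow_mul_exp_neg {p q : ℝ} (hp : 0 < p) (hq : 0 < q) :
    ∫⁻ t in Set.Ioi (0 : ℝ), ENNReal.ofReal (t ^ (p - 1) * Real.exp (-(q * t)))
      = ENNReal.ofReal ((1 / q) ^ p * Real.Gamma p) := by
  rw [← Real.integral_rpow_mul_exp_neg_mul_Ioi hp hq, ofReal_integral_eq_lintegral_ofReal]
  · refine Integrable.of_integral_ne_zero ?_
    rw [Real.integral_rpow_mul_exp_neg_mul_Ioi hp hq]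
    have := Real.Gamma_pos_of_pos hp
    positivity
  · refine (ae_restrict_iff' measurableSet_Ioi).2 (ae_of_all _ fun t ht => ?_)
    have ht : 0 < t := ht
    positivity

/-- The Rician shadowed power density at `v`: the diffuse component has variance `s`, and the power
of the constant-modulus component is `β` times a Gamma variable of shape and rate `m`. -/
noncomputable def shadowedRicePDF (β m s v : ℝ) : ℝ :=
  m ^ m * s ^ (m - 1) / (m * s + β) ^ m * Real.exp (-(v / s))
    * kummer m 1 (β * v / (s * (m * s + β)))

lemma measurable_shadowedRicePDF (β : ℝ) {m : ℝ} (hm : 0 < m) :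
    Measurable (fun q : ℝ × ℝ => shadowedRicePDF β m q.1 q.2) := by
  unfold shadowedRicePDF
  exact Measurable.mul (by fun_prop) ((measurable_kummer hm).comp (by fun_prop))

lemma pdfIntegrand_eq_shadowedRicePDF {α β m γbar u x s : ℝ} (hm : 0 < m) (hγ : 0 < γbar)
    (hβ : 0 ≤ β) (hs : 0 < s) (hsx : s = 1 - β - α * (1 - x)) :
    pdfIntegrand α β m γbar u x
      = Real.exp (-x) * (1 / γbar * shadowedRicePDF β m s (u / γbar)) := by
  rw [pdfIntegrand_eq hm hγ hβ hs hsx, shadowedRicePDF]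
  have e1 : u / γbar / s = u / (s * γbar) := by field_simp
  have e2 : β * (u / γbar) / (s * (m * s + β)) = β * u / (s * γbar * (m * s + β)) := by
    field_simp
  rw [e1, e2]
  ring

/-- Averaging the Rician density over a Gamma distributed power of the constant-modulus component,
term by term in the Bessel series, produces Kummer's function. -/
lemma lintegral_gamma_rice {m β s v : ℝ} (hm : 0 < m) (hβ : 0 ≤ β) (hs : 0 < s) (hv : 0 < v) :
    ∫⁻ ξ, ENNReal.ofReal (1 / s * Real.exp (-(v + β * ξ) / s)) * besselSeries (β * ξ * v / s ^ 2)
        ∂(gammaMeasure m m)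
      = ENNReal.ofReal (shadowedRicePDF β m s v) := by
  rw [shadowedRicePDF]
  have hG := Real.Gamma_pos_of_pos hm
  have hd : 0 < m * s + β := by positivity
  have hq : 0 < m + β / s := by positivity
  have hqe : m + β / s = (m * s + β) / s := by field_simp
  rw [lintegral_gammaMeasure m (by fun_prop)]
  have hterm : ∀ ξ ∈ Set.Ioi (0 : ℝ), ENNReal.ofReal (m ^ m / Real.Gamma m * ξ ^ (m - 1)
        * Real.exp (-(m * ξ))) * (ENNReal.ofReal (1 / s * Real.exp (-(v + β * ξ) / s))
          * besselSeries (β * ξ * v / s ^ 2))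
      = ∑' n : ℕ, ENNReal.ofReal (m ^ m / Real.Gamma m * (1 / s * Real.exp (-(v / s)))
          * ((β * v / s ^ 2) ^ n / (n.factorial : ℝ) ^ 2))
          * ENNReal.ofReal (ξ ^ (m + n - 1) * Real.exp (-((m + β / s) * ξ))) := by
    intro ξ hξ
    have hξ : 0 < ξ := hξ
    rw [besselSeries, ← ENNReal.tsum_mul_left, ← ENNReal.tsum_mul_left]
    refine tsum_congr fun n => ?_
    rw [← ENNReal.ofReal_mul (by positivity), ← ENNReal.ofReal_mul (by positivity),
      ← ENNReal.ofReal_mul (by positivity)]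
    congr 1
    have e1 : Real.exp (-(v + β * ξ) / s)
        = Real.exp (-(v / s)) * Real.exp (-(β / s * ξ)) := by
      rw [← Real.exp_add]; congr 1; ring
    have e2 : Real.exp (-((m + β / s) * ξ)) = Real.exp (-(m * ξ)) * Real.exp (-(β / s * ξ)) := by
      rw [← Real.exp_add]; congr 1; ring
    have e3 : ξ ^ (m + n - 1) = ξ ^ (m - 1) * ξ ^ n := by
      rw [← Real.rpow_natCast, ← Real.rpow_add hξ]; congr 1; ring
    rw [e1, e2, e3]
    ring
  rw [setLIntegral_congr_fun measurableSet_Ioi hterm, lintegral_tsum fun n => by fun_prop]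
  have hy : 0 ≤ β * v / (s * (m * s + β)) := by positivity
  have hmul : ENNReal.ofReal (m ^ m * s ^ (m - 1) / (m * s + β) ^ m * Real.exp (-(v / s))
          * kummer m 1 (β * v / (s * (m * s + β))))
      = ∑' n : ℕ, ENNReal.ofReal (m ^ m * s ^ (m - 1) / (m * s + β) ^ m * Real.exp (-(v / s))
          * ((ascPochhammer ℝ n).eval m / (ascPochhammer ℝ n).eval 1
            * ((β * v / (s * (m * s + β))) ^ n / (n.factorial : ℝ)))) := by
    rw [kummer, ← tsum_mul_left, ENNReal.ofReal_tsum_of_nonneg]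
    · intro n
      have := kummer_term_nonneg hm hy n
      positivity
    · exact (summable_kummer hm hy).mul_left _
  rw [hmul]
  refine tsum_congr fun n => ?_
  rw [lintegral_const_mul _ (by fun_prop), lintegral_rpow_mul_exp_neg (by positivity) hq,
    Gamma_add_nat hm, ← ENNReal.ofReal_mul (by positivity), ascPochhammer_eval_one]
  congr 1
  rw [hqe, one_div_div, Real.rpow_add (by positivity), Real.rpow_natCast,
    Real.div_rpow hs.le hd.le, Real.rpow_sub_one hs.ne', div_pow, div_pow, div_pow, mul_pow s,
    pow_right_comm s]
  have : 0 < (m * s + β) ^ m := by positivity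
  field_simp

/-! ### The law of the instantaneous SNR -/

lemma lintegral_comp_div_const {c : ℝ} (hc : 0 < c) (g : ℝ → ℝ≥0∞) :
    ∫⁻ u in Set.Ioi (0 : ℝ), ENNReal.ofReal (1 / c) * g (u / c)
      = ∫⁻ v in Set.Ioi (0 : ℝ), g v := by
  have himg : (fun u : ℝ => u / c) '' Set.Ioi 0 = Set.Ioi 0 := by
    ext v
    constructor
    · rintro ⟨u, hu, rfl⟩
      exact div_pos hu hc
    · intro hv
      exact ⟨v * c, mul_pos hv hc, mul_div_cancel_right₀ v hc.ne'⟩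
  have hinj : Set.InjOn (fun u : ℝ => u / c) (Set.Ioi 0) := fun a _ b _ hab =>
    (div_left_inj' hc.ne').1 hab
  have := lintegral_image_eq_lintegral_abs_deriv_mul (f := fun u : ℝ => u / c)
    (f' := fun _ => 1 / c) measurableSet_Ioi
    (fun x _ => ((hasDerivAt_id x).div_const c).hasDerivWithinAt) hinj g
  rw [himg] at this
  rw [this, abs_of_pos (by positivity)]

lemma measurable_signal (ω₀ ω₁ ω₂ : ℝ) : Measurable (signal ω₀ ω₁ ω₂) := by
  unfold signal
  fun_prop

/-- Conditionally on `G₃ = g ≠ 0`, the received power is a Rician shadowed variable whose diffuse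
variance is `ω₁² + ω₂² |g|²`. -/
lemma lintegral_conditional_power {ω₀ ω₁ ω₂ m : ℝ} (hm : 0 < m) {g : ℂ}
    (hs : 0 < ω₁ ^ 2 + ω₂ ^ 2 * ‖g‖ ^ 2) {h : ℝ → ℝ≥0∞} (hh : Measurable h) :
    ∫⁻ ξ, ∫⁻ φ, ∫⁻ p, h (‖signal ω₀ ω₁ ω₂ (ξ, φ, p.1, p.2, g)‖ ^ 2)
        ∂((complexNormal 0 1).prod (complexNormal 0 1)) ∂uniformPhase ∂(gammaMeasure m m)
      = ∫⁻ v in Set.Ioi (0 : ℝ), ENNReal.ofReal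
          (shadowedRicePDF (ω₀ ^ 2) m (ω₁ ^ 2 + ω₂ ^ 2 * ‖g‖ ^ 2) v) * h v := by
  have := isProbabilityMeasure_gammaMeasure hm hm
  obtain ⟨s, hsdef⟩ : ∃ s : ℝ≥0, (s : ℝ) = ω₁ ^ 2 + ω₂ ^ 2 * ‖g‖ ^ 2 := ⟨⟨_, hs.le⟩, rfl⟩
  rw [← hsdef] at hs ⊢
  have hs0 : s ≠ 0 := fun h0 => by simp [h0] at hs
  have hlaw := map_linear_complexNormal (ω₁ : ℂ) (ω₂ * g) s (by
    rw [hsdef, norm_mul, mul_pow, Complex.norm_real, Complex.norm_real, Real.norm_eq_abs,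
      Real.norm_eq_abs, sq_abs, sq_abs])
  have hinner : ∀ ξ φ : ℝ, ∫⁻ p, h (‖signal ω₀ ω₁ ω₂ (ξ, φ, p.1, p.2, g)‖ ^ 2)
        ∂((complexNormal 0 1).prod (complexNormal 0 1))
      = ∫⁻ z, h (‖((ω₀ * √ξ : ℝ) : ℂ) * Complex.exp (Complex.I * (φ : ℂ)) + z‖ ^ 2)
        ∂(complexNormal 0 s) := fun ξ φ => by
    rw [← hlaw, lintegral_map (by fun_prop) (by fun_prop)]
    refine lintegral_congr fun p => ?_
    congr 3
    simp only [signal]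
    push_cast
    ring
  simp_rw [hinner, lintegral_rice hs0 _ hh]
  rw [lintegral_lintegral_swap (by fun_prop)]
  refine setLIntegral_congr_fun measurableSet_Ioi fun v hv => ?_
  rw [lintegral_mul_const _ (by fun_prop), ← lintegral_gamma_rice hm (sq_nonneg ω₀) hs hv]
  congr 1
  -- the Gamma law charges only `ξ > 0`, where `(ω₀ √ξ)² = ω₀² ξ`
  rw [lintegral_gammaMeasure m (by fun_prop), lintegral_gammaMeasure m (by fun_prop)]
  refine setLIntegral_congr_fun measurableSet_Ioi fun ξ hξ => ?_
  rw [mul_pow, Real.sq_sqrt (le_of_lt hξ)]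

/-- Conditioning on `G₃` last: the other variables are integrated out for fixed `G₃`. -/
lemma lintegral_sourceLaw {m : ℝ} (hm : 0 < m) {H : ℝ × ℝ × ℂ × ℂ × ℂ → ℝ≥0∞}
    (hH : Measurable H) :
    ∫⁻ s, H s ∂(sourceLaw m)
      = ∫⁻ g, ∫⁻ ξ, ∫⁻ φ, ∫⁻ p, H (ξ, φ, p.1, p.2, g)
        ∂((complexNormal 0 1).prod (complexNormal 0 1)) ∂uniformPhase ∂(gammaMeasure m m)
        ∂(complexNormal 0 1) := by
  have := isProbabilityMeasure_gammaMeasure hm hm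
  have hp : ∀ ξ φ : ℝ, ∫⁻ q, H (ξ, φ, q)
        ∂((complexNormal 0 1).prod ((complexNormal 0 1).prod (complexNormal 0 1)))
      = ∫⁻ g, ∫⁻ p, H (ξ, φ, p.1, p.2, g)
        ∂((complexNormal 0 1).prod (complexNormal 0 1)) ∂(complexNormal 0 1) := fun ξ φ => by
    rw [← (measurePreserving_prodAssoc (complexNormal 0 1) (complexNormal 0 1)
      (complexNormal 0 1)).lintegral_comp_emb MeasurableEquiv.prodAssoc.measurableEmbedding,
      lintegral_prod_symm _ (by fun_prop)]
    rfl
  have hm1 : Measurable (fun q : (ℝ × ℝ × ℂ) × (ℂ × ℂ) =>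
      H (q.1.1, q.1.2.1, q.2.1, q.2.2, q.1.2.2)) := by fun_prop
  have hm2 : Measurable (fun q : ℝ × ℝ × ℂ => ∫⁻ p, H (q.1, q.2.1, p.1, p.2, q.2.2)
      ∂((complexNormal 0 1).prod (complexNormal 0 1))) := hm1.lintegral_prod_right'
  have hm3 : Measurable (fun q : (ℝ × ℂ) × ℝ => ∫⁻ p, H (q.1.1, q.2, p.1, p.2, q.1.2)
      ∂((complexNormal 0 1).prod (complexNormal 0 1))) :=
    hm2.comp (show Measurable (fun q : (ℝ × ℂ) × ℝ => (q.1.1, q.2, q.1.2)) by fun_prop)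
  rw [sourceLaw, lintegral_prod _ hH.aemeasurable]
  have hφ : ∀ ξ : ℝ, ∫⁻ q, H (ξ, q) ∂(uniformPhase.prod
        ((complexNormal 0 1).prod ((complexNormal 0 1).prod (complexNormal 0 1))))
      = ∫⁻ φ, ∫⁻ q, H (ξ, φ, q)
        ∂((complexNormal 0 1).prod ((complexNormal 0 1).prod (complexNormal 0 1))) ∂uniformPhase :=
    fun ξ => lintegral_prod _ (by fun_prop)
  simp_rw [hφ, hp]
  have hswap : ∀ ξ : ℝ, ∫⁻ φ, ∫⁻ g, ∫⁻ p, H (ξ, φ, p.1, p.2, g)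
        ∂((complexNormal 0 1).prod (complexNormal 0 1)) ∂(complexNormal 0 1) ∂uniformPhase
      = ∫⁻ g, ∫⁻ φ, ∫⁻ p, H (ξ, φ, p.1, p.2, g)
        ∂((complexNormal 0 1).prod (complexNormal 0 1)) ∂uniformPhase ∂(complexNormal 0 1) :=
    fun ξ => lintegral_lintegral_swap
      (hm2.comp (show Measurable (fun q : ℝ × ℂ => (ξ, q.1, q.2)) by fun_prop)).aemeasurable
  simp_rw [hswap]
  exact lintegral_lintegral_swap hm3.lintegral_prod_right'.aemeasurable

/-- The SNR has the integral form of the density, with the integral taken in `[0, ∞]`; mixing over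
`x = |G₃|²` is legitimate without knowing that the integral is finite. -/
lemma snrLaw_eq_withDensity {ω₀ ω₁ ω₂ m γbar : ℝ} (hm : 0 < m) (hγ : 0 < γbar)
    (hω : ω₀ ^ 2 + ω₁ ^ 2 + ω₂ ^ 2 = 1) (hβ : ω₀ ^ 2 < 1) :
    snrLaw ω₀ ω₁ ω₂ m γbar = volume.withDensity ((Set.Ioi (0 : ℝ)).indicator fun u =>
      ∫⁻ x in Set.Ioi (0 : ℝ), ENNReal.ofReal (pdfIntegrand (ω₂ ^ 2) (ω₀ ^ 2) m γbar u x)) := by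
  have hsig := measurable_signal ω₀ ω₁ ω₂
  have hpdf : Measurable (fun q : ℝ × ℝ =>
      ENNReal.ofReal (pdfIntegrand (ω₂ ^ 2) (ω₀ ^ 2) m γbar q.1 q.2)) :=
    (measurable_pdfIntegrand _ _ _ hm).ennreal_ofReal
  have hdens : Measurable (fun u =>
      ∫⁻ x in Set.Ioi (0 : ℝ), ENNReal.ofReal (pdfIntegrand (ω₂ ^ 2) (ω₀ ^ 2) m γbar u x)) :=
    hpdf.lintegral_prod_right'
  have hpdfu : ∀ u, Measurable (fun x =>
      ENNReal.ofReal (pdfIntegrand (ω₂ ^ 2) (ω₀ ^ 2) m γbar u x)) :=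
    fun u => by
      have := hpdf.comp (measurable_prodMk_left (x := u))
      exact this
  have hprod : ∀ h : ℝ → ℝ≥0∞, Measurable h → Measurable (Function.uncurry fun x u : ℝ =>
      ENNReal.ofReal (pdfIntegrand (ω₂ ^ 2) (ω₀ ^ 2) m γbar u x) * h u) := fun h hh =>
    by
    have := hpdf.comp measurable_swap
    exact this.mul (hh.comp measurable_snd)
  have hspos : ∀ x : ℝ, 0 < x → 0 < ω₁ ^ 2 + ω₂ ^ 2 * x := fun x hx => by
    rcases eq_or_ne ω₂ 0 with rfl | h2
    · nlinarith
    · positivity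
  have hsx : ∀ x : ℝ, ω₁ ^ 2 + ω₂ ^ 2 * x = 1 - ω₀ ^ 2 - ω₂ ^ 2 * (1 - x) := fun x => by
    linear_combination hω
  refine Measure.ext_of_lintegral _ fun h hh => ?_
  have hinner : Measurable (fun q : ℝ × ℝ =>
      ENNReal.ofReal (shadowedRicePDF (ω₀ ^ 2) m (ω₁ ^ 2 + ω₂ ^ 2 * q.1) q.2)
        * h (γbar * q.2)) :=
    ((measurable_shadowedRicePDF (ω₀ ^ 2) hm).comp (show Measurable (fun q : ℝ × ℝ =>
      (ω₁ ^ 2 + ω₂ ^ 2 * q.1, q.2)) by fun_prop)).ennreal_ofReal.mul (by fun_prop)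
  rw [snrLaw, lintegral_map hh (by fun_prop), lintegral_sourceLaw hm (by fun_prop),
    lintegral_withDensity_eq_lintegral_mul _ (hdens.indicator measurableSet_Ioi) hh]
  -- for `G₃ = 0` the diffuse variance may be zero, so this null event is discarded
  have hne : ∀ᵐ g ∂(complexNormal 0 1), g ≠ 0 := by
    rw [complexNormal_eq_withDensity one_ne_zero]
    exact (withDensity_absolutelyContinuous _ _).ae_le (Measure.ae_ne volume 0)
  have hcond := fun g : ℂ => fun hg : g ≠ 0 => lintegral_conditional_power (ω₀ := ω₀) (ω₁ := ω₁)
    (ω₂ := ω₂) (g := g) hm (hspos (‖g‖ ^ 2) (by positivity))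
    (h := fun v => h (γbar * v)) (by fun_prop)
  rw [lintegral_congr_ae (hne.mono hcond)]
  rw [lintegral_complexNormal_normSq (h := fun x => ∫⁻ v in Set.Ioi (0 : ℝ),
    ENNReal.ofReal (shadowedRicePDF (ω₀ ^ 2) m (ω₁ ^ 2 + ω₂ ^ 2 * x) v) * h (γbar * v))
    hinner.lintegral_prod_right']
  have hx : ∀ x ∈ Set.Ioi (0 : ℝ), ENNReal.ofReal (Real.exp (-x)) * ∫⁻ v in Set.Ioi (0 : ℝ),
      ENNReal.ofReal (shadowedRicePDF (ω₀ ^ 2) m (ω₁ ^ 2 + ω₂ ^ 2 * x) v) * h (γbar * v)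
      = ∫⁻ u in Set.Ioi (0 : ℝ),
          ENNReal.ofReal (pdfIntegrand (ω₂ ^ 2) (ω₀ ^ 2) m γbar u x) * h u := by
    intro x hx
    have hs := hspos x hx
    have hv : Measurable (fun v =>
        ENNReal.ofReal (shadowedRicePDF (ω₀ ^ 2) m (ω₁ ^ 2 + ω₂ ^ 2 * x) v) * h (γbar * v)) := by
      have := hinner.comp (measurable_prodMk_left (x := x))
      exact this
    rw [← lintegral_const_mul _ hv]
    refine (lintegral_comp_div_const hγ _).symm.trans ?_
    refine setLIntegral_congr_fun measurableSet_Ioi fun u hu => ?_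
    rw [pdfIntegrand_eq_shadowedRicePDF hm hγ (sq_nonneg ω₀) hs (hsx x),
      mul_div_cancel₀ _ hγ.ne', ENNReal.ofReal_mul (Real.exp_pos _).le,
      ENNReal.ofReal_mul (by positivity)]
    ring
  rw [setLIntegral_congr_fun measurableSet_Ioi hx, lintegral_lintegral_swap
    (hprod h hh).aemeasurable,
    ← lintegral_indicator measurableSet_Ioi]
  refine lintegral_congr fun u => ?_
  by_cases hu : u ∈ Set.Ioi (0 : ℝ)
  · simp only [Pi.mul_apply, Set.indicator_of_mem hu]
    exact lintegral_mul_const _ (hpdfu u)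
  · simp [Set.indicator_of_notMem hu]

end FSOSF

theorem lemma1 {Ω : Type*} [MeasurableSpace Ω] (P : Measure Ω) [IsProbabilityMeasure P]
    (γ : Ω → ℝ) (α β m γbar : ℝ) (hm : 0 < m) (hγbar : 0 < γbar) (hβ : β < 1)
    (hγ : FSOSF.IsFSOSF P γ α β m γbar) :
    -- `γ` has a density, given by the integral form for real `m > 0`
    HasPDF γ P volume ∧
    (∀ u : ℝ, 0 < u →
      IntegrableOn (fun x => FSOSF.pdfIntegrand α β m γbar u x) (Set.Ioi 0) volume) ∧
    pdf γ P volume =ᵐ[volume]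
      (fun u => ENNReal.ofReal (if 0 < u then FSOSF.pdfIntegral α β m γbar u else 0)) ∧
    -- and by the finite sum when `m` is a positive integer
    (∀ n : ℕ, m = n → 0 < α →
      (∀ u : ℝ, 0 < u → ∀ j < n, ∀ r ≤ j,
        IntegrableOn
          (fun t => FSOSF.genGammaIntegrand ((r : ℝ) - 2 * n + j + 2) (u / (α * γbar)) t)
          (Set.Ioi (FSOSF.lowerLimit α β n)) volume) ∧
      (∀ u : ℝ, 0 < u → FSOSF.pdfIntegral α β m γbar u = FSOSF.pdfSum α β n γbar u) ∧
      pdf γ P volume =ᵐ[volume]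
        (fun u => ENNReal.ofReal (if 0 < u then FSOSF.pdfSum α β n γbar u else 0))) := by
  obtain ⟨ω₀, ω₁, ω₂, hω, hα, hβ', hlaw⟩ := hγ
  rw [hω, div_one] at hα hβ'
  subst hα hβ'
  have hω1 : 0 ≤ ω₁ ^ 2 := sq_nonneg _
  have hαβ : ω₂ ^ 2 + ω₀ ^ 2 ≤ 1 := by linarith
  have hint : ∀ u : ℝ, 0 < u → IntegrableOn
      (fun x => FSOSF.pdfIntegrand (ω₂ ^ 2) (ω₀ ^ 2) m γbar u x) (Set.Ioi 0) volume := fun u hu =>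
    FSOSF.integrableOn_pdfIntegrand hm hγbar (sq_nonneg _) (sq_nonneg _) hβ hαβ hu
  have hmeas : Measurable ((Set.Ioi (0 : ℝ)).indicator fun u => ∫⁻ x in Set.Ioi (0 : ℝ),
      ENNReal.ofReal (FSOSF.pdfIntegrand (ω₂ ^ 2) (ω₀ ^ 2) m γbar u x)) :=
    Measurable.indicator (Measurable.lintegral_prod_right'
      (f := fun q : ℝ × ℝ =>
        ENNReal.ofReal (FSOSF.pdfIntegrand (ω₂ ^ 2) (ω₀ ^ 2) m γbar q.1 q.2))
      (FSOSF.measurable_pdfIntegrand _ _ _ hm).ennreal_ofReal) measurableSet_Ioi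
  have hmap : P.map γ = volume.withDensity ((Set.Ioi (0 : ℝ)).indicator fun u =>
      ∫⁻ x in Set.Ioi (0 : ℝ),
        ENNReal.ofReal (FSOSF.pdfIntegrand (ω₂ ^ 2) (ω₀ ^ 2) m γbar u x)) :=
    hlaw.map_eq.trans (FSOSF.snrLaw_eq_withDensity hm hγbar hω hβ)
  have hpdf : pdf γ P volume =ᵐ[volume]
      (fun u => ENNReal.ofReal
        (if 0 < u then FSOSF.pdfIntegral (ω₂ ^ 2) (ω₀ ^ 2) m γbar u else 0)) := by
    rw [pdf_def, hmap]
    refine (Measure.rnDeriv_withDensity volume hmeas).trans (ae_of_all _ fun u => ?_)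
    simp only [Set.indicator_apply, Set.mem_Ioi]
    split_ifs with hu
    · refine (ofReal_integral_eq_lintegral_ofReal (hint u hu) ?_).symm
      refine (ae_restrict_iff' measurableSet_Ioi).2 (ae_of_all _ fun x hx => ?_)
      have hx : 0 < x := hx
      refine FSOSF.pdfIntegrand_nonneg hm hγbar (sq_nonneg _) ?_ hu.le
      rcases eq_or_ne ω₂ 0 with rfl | h2
      · linarith
      · have : 0 < ω₂ ^ 2 * x := by positivity
        linarith
    · simp
  refine ⟨?_, hint, hpdf, fun n hn hα => ?_⟩
  · rw [Real.hasPDF_iff_of_aemeasurable hlaw.aemeasurable, hmap]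
    exact withDensity_absolutelyContinuous _ _
  · subst hn
    have hn : 0 < n := by exact_mod_cast hm
    have heq : ∀ u : ℝ, 0 < u → FSOSF.pdfIntegral (ω₂ ^ 2) (ω₀ ^ 2) n γbar u
        = FSOSF.pdfSum (ω₂ ^ 2) (ω₀ ^ 2) n γbar u := fun u hu =>
      FSOSF.pdfIntegral_eq_pdfSum hn hγbar hα (sq_nonneg _) hαβ hu
    refine ⟨fun u hu j _ r _ => FSOSF.integrableOn_genGammaIntegrand _
      (FSOSF.lowerLimit_nonneg (sq_nonneg _) (sq_nonneg _) hαβ) (by positivity), heq, ?_⟩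
    filter_upwards [hpdf] with u hu
    rw [hu]
    split_ifs with h0
    · rw [heq u h0]
    · rfl
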